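/- Let $n\ge 1$ and $N\ge 3$ be integers, let $C_N$ be the cycle on $N$ vertices, and let $C_N^n$ be its $n$-th power: the graph on the same vertex set in which two distinct vertices are adjacent if and only if their distance in $C_N$ is at most $n$. For a finite graph $G$ without isolated vertices, the Z-domination game on $G$ is played by Dominator and Staller, who alternately choose a vertex, with Dominator moving first. After the vertices $v_1,\dots,v_{i-1}$ have been chosen, the choice of a vertex $v_i$ is legal if $$N(v_i)\setminus\bigcup_{j=1}^{i-1}N[v_j]\neq\emptyset,$$ where $N(v)$ is the open and $N[v]=N(v)\cup\{v\}$ the closed neighborhood of $v$. The game ends when there is no legal move. Dominator wants the total number of moves to be as small as possible, and Staller wants it to be as large as possible. The game Z-domination number $\gamma_{Zg}(G)$ is the total number of moves when both play optimally. Then $$\gamma_{Zg}(C_N^n)=\begin{cases}\left\lceil \dfrac{N}{n+1}\right\rceil & \text{if } N \bmod (2n+2)\in\{0,1,\dots,n+1\},\\[2ex] \left\lceil \dfrac{N}{n+1}\right\rceil-1 & \text{if } N\bmod (2n+2)\in\{n+2,\dots,2n+1\}.\end{cases}$$ -/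

import Mathlib

/-- The `n`-th power of a graph: distinct vertices are adjacent when their distance in `G`
is at most `n`. -/
def graphPower {V : Type*} (G : SimpleGraph V) (n : ℕ) : SimpleGraph V where
  Adj u v := u ≠ v ∧ G.edist u v ≤ n
  symm := ⟨fun u v h => ⟨h.1.symm, by rw [SimpleGraph.edist_comm]; exact h.2⟩⟩
  loopless := ⟨fun _ h => h.1 rfl⟩

/-- The two players of a domination game. -/
inductive DomPlayer : Type
  | dominator
  | staller

section ZGame

/-- The closed neighborhood `N[v]`. -/
def closedNbhd {V : Type*} [Fintype V] [DecidableEq V] (G : SimpleGraph V)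
    [DecidableRel G.Adj] (v : V) : Finset V :=
  insert v (G.neighborFinset v)

/-- The vertices that are dominated once the vertices of `S` have been played. -/
def dominatedBy {V : Type*} [Fintype V] [DecidableEq V] (G : SimpleGraph V)
    [DecidableRel G.Adj] (S : Finset V) : Finset V :=
  S.biUnion (closedNbhd G)

/-- The legal moves of the Z-domination game once the vertices of `S` have been played:
those `v` for which `N(v)` is not contained in the union of the `N[u]`, `u ∈ S`. -/
def zLegalMoves {V : Type*} [Fintype V] [DecidableEq V] (G : SimpleGraph V)
    [DecidableRel G.Adj] (S : Finset V) : Finset V :=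
  Finset.univ.filter fun v => (G.neighborFinset v \ dominatedBy G S).Nonempty

theorem notMem_of_mem_zLegalMoves {V : Type*} [Fintype V] [DecidableEq V] (G : SimpleGraph V)
    [DecidableRel G.Adj] {S : Finset V} {v : V} (hv : v ∈ zLegalMoves G S) : v ∉ S := by
  intro hS
  obtain ⟨w, hw⟩ := (Finset.mem_filter.mp hv).2
  rw [Finset.mem_sdiff] at hw
  exact hw.2 (Finset.mem_biUnion.mpr ⟨v, hS, Finset.mem_insert_of_mem hw.1⟩)

/-- The number of moves still to be played in the Z-domination game on `G` under optimal play,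
when the vertices of `S` have been played and the given player is next to move.
The game ends when there is no legal move; Dominator minimizes and Staller maximizes the
number of moves. -/
def zGameLength {V : Type*} [Fintype V] [DecidableEq V] (G : SimpleGraph V)
    [DecidableRel G.Adj] (p : DomPlayer) (S : Finset V) : ℕ :=
  if h : (zLegalMoves G S).Nonempty then
    match p with
    | .dominator => 1 + (zLegalMoves G S).attach.inf' (Finset.attach_nonempty_iff.mpr h)
        fun v => zGameLength G .staller (insert v.1 S)
    | .staller => 1 + (zLegalMoves G S).attach.sup' (Finset.attach_nonempty_iff.mpr h)
        fun v => zGameLength G .dominator (insert v.1 S)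
  else 0
termination_by Fintype.card V - S.card
decreasing_by
  all_goals
    have h1 := Finset.card_insert_of_notMem (notMem_of_mem_zLegalMoves G v.2)
    have h2 := Finset.card_le_univ (insert v.1 S)
    omega

/-- The game Z-domination number: the length, under optimal play, of the Z-domination game
that Dominator starts. -/
def gameZDominationNumber {V : Type*} [Fintype V] [DecidableEq V] (G : SimpleGraph V)
    [DecidableRel G.Adj] : ℕ :=
  zGameLength G .dominator ∅

end ZGame

/-! On the cycle a closed neighborhood in the power graph is an arc of `2n+1` consecutive vertices.
Optimal play is as if Dominator dominated `2n+1` new vertices per move and Staller one, so the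
length is the least `j` with `moveBudget n .dominator j ≥ N`.

Staller achieves her side by playing next to an earlier vertex whose arc ends at an undominated run:
the shifted arc adds one vertex, while no Dominator move adds more than `2n+1` (`lt_zGameLength`).

Dominator cannot always find `2n+1` new vertices, so he controls a potential instead: undominated
vertices plus `2n` per run of them. Filling a run from its start lowers it by at least `2n+1`, any
legal reply lowers it by at least 1, and a value at most `2n` means that everything is dominated
(`zGameLength_le`). After the first move it is below `N`, so the two bounds meet. -/

/-! ### Arcs, runs and the potential in a cyclic group. -/

section Arcs

variable {A : Type*} [AddCommGroup A] [Fintype A] [DecidableEq A]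

/-- The arc of `m` consecutive elements `a, a + g, …, a + (m - 1) g`. -/
def arc (g : A) (m : ℕ) (a : A) : Finset A :=
  (Finset.range m).image fun i => a + i • g

/-- The elements outside `D` whose predecessor lies in `D`: the starting points of the runs
of the complement of `D`. -/
def runStarts (g : A) (D : Finset A) : Finset A :=
  Finset.univ.filter fun u => u ∉ D ∧ u - g ∈ D

/-- Dominator's potential: the number of elements outside `D`, plus `c` for each run that
they form. -/
def runPotential (g : A) (c : ℕ) (D : Finset A) : ℕ :=
  Dᶜ.card + c * (runStarts g D).card

theorem mem_arc {g : A} {m : ℕ} {a x : A} : x ∈ arc g m a ↔ ∃ i < m, a + i • g = x := by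
  simp [arc]

theorem mem_runStarts {g : A} {D : Finset A} {u : A} :
    u ∈ runStarts g D ↔ u ∉ D ∧ u - g ∈ D := by
  simp [runStarts]

theorem eq_univ_of_add_mem {g : A} (hg : ∀ x : A, ∃ k : ℕ, k • g = x) {D : Finset A}
    (hD : D.Nonempty) (h : ∀ x ∈ D, x + g ∈ D) : D = Finset.univ := by
  obtain ⟨a, ha⟩ := hD
  have key : ∀ k : ℕ, a + k • g ∈ D := by
    intro k
    induction k with
    | zero => simpa using ha
    | succ k ih => rw [succ_nsmul, ← add_assoc]; exact h _ ih
  refine Finset.eq_univ_of_forall fun x => ?_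
  obtain ⟨k, hk⟩ := hg (x - a)
  have := key k
  rwa [hk, add_sub_cancel] at this

theorem exists_mem_runStarts {g : A} (hg : ∀ x : A, ∃ k : ℕ, k • g = x) {D : Finset A}
    (hD : D.Nonempty) (h : D ≠ Finset.univ) : ∃ u, u ∈ runStarts g D := by
  by_contra! hu
  refine h (eq_univ_of_add_mem hg hD fun x hx => ?_)
  by_contra hx'
  exact hu (x + g) (mem_runStarts.mpr ⟨hx', by simpa using hx⟩)

/-- Handles wrap-around: if the order of `g` is at most the arc length, the arc goes all the way
round. -/
theorem arc_eq_univ_of_nsmul_eq_zero {g : A} (hg : ∀ x : A, ∃ k : ℕ, k • g = x) {k m : ℕ}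
    (hk : 0 < k) (hkm : k ≤ m) (h : k • g = 0) (a : A) : arc g m a = Finset.univ := by
  refine Finset.eq_univ_of_forall fun x => mem_arc.mpr ?_
  obtain ⟨j, hj⟩ := hg (x - a)
  refine ⟨j % k, (Nat.mod_lt j hk).trans_le hkm, ?_⟩
  have h1 : j • g = (j % k) • g := by
    conv_lhs => rw [← Nat.mod_add_div j k, add_nsmul, mul_comm, mul_nsmul', h, nsmul_zero, add_zero]
  rw [← h1, hj, add_sub_cancel]

theorem card_arc {g : A} (hg : ∀ x : A, ∃ k : ℕ, k • g = x) {m : ℕ} {a : A}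
    (h : arc g m a ≠ Finset.univ) : (arc g m a).card = m := by
  rw [arc, Finset.card_image_of_injOn, Finset.card_range]
  have key : ∀ i j : ℕ, i < j → j < m → a + i • g ≠ a + j • g := by
    intro i j hij hj hEq
    refine h (arc_eq_univ_of_nsmul_eq_zero hg (k := j - i) (by omega) (by omega) ?_ a)
    have h2 : j • g = (j - i) • g + i • g := by rw [← add_nsmul]; congr 1; omega
    have h3 := add_left_cancel hEq
    rw [h2] at h3
    simpa using h3.symm
  intro i hi j hj hEq
  simp only [Finset.coe_range, Set.mem_Iio] at hi hj
  rcases lt_trichotomy i j with hlt | rfl | hlt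
  · exact absurd hEq (key i j hlt hj)
  · rfl
  · exact absurd hEq.symm (key j i hlt hi)

theorem runStarts_univ (g : A) : runStarts g (Finset.univ : Finset A) = ∅ := by
  simp [runStarts]

theorem runPotential_univ (g : A) (c : ℕ) : runPotential g c (Finset.univ : Finset A) = 0 := by
  simp [runPotential, runStarts_univ]

/-- Adding an arc removes the run starts inside it and can only create one at its end. -/
theorem runStarts_union_arc_subset (g : A) (m : ℕ) (a : A) (D : Finset A) :
    runStarts g (D ∪ arc g m a) ⊆ insert (a + m • g) (runStarts g D \ arc g m a) := by
  intro u hu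
  simp only [mem_runStarts, Finset.mem_union, not_or] at hu
  obtain ⟨⟨hu1, hu2⟩, h | h⟩ := hu
  · exact Finset.mem_insert_of_mem (Finset.mem_sdiff.mpr ⟨mem_runStarts.mpr ⟨hu1, h⟩, hu2⟩)
  · obtain ⟨i, hi, hiu⟩ := mem_arc.mp h
    have hu' : a + (i + 1) • g = u := by
      rw [succ_nsmul, ← add_assoc, hiu, sub_add_cancel]
    have : i + 1 = m := by
      by_contra hne
      exact hu2 (mem_arc.mpr ⟨i + 1, by omega, hu'⟩)
    rw [← hu', this]
    exact Finset.mem_insert_self _ _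

/-- If an arc meets `D` and a run outside `D` goes on past the end of the arc, then that run
starts at a positive offset from the start of the arc. -/
theorem exists_runStart_of_mem {g : A} {m i : ℕ} {a : A} {D : Finset A} (hi : i < m)
    (hiD : a + i • g ∈ D) (hm : a + m • g ∉ D) :
    ∃ k, 0 < k ∧ k ≤ m ∧ a + k • g ∈ runStarts g D := by
  by_contra! h
  have key : ∀ j, i + j ≤ m → a + (i + j) • g ∈ D := by
    intro j
    induction j with
    | zero => intro _; simpa using hiD
    | succ j ih =>
      intro hj
      by_contra hn
      refine h (i + (j + 1)) (by omega) hj (mem_runStarts.mpr ⟨hn, ?_⟩)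
      have := ih (by omega)
      rwa [← add_assoc i j 1, succ_nsmul, ← add_assoc, add_sub_cancel_right]
  have := key (m - i) (by omega)
  rw [Nat.add_sub_cancel' hi.le] at this
  exact hm this

theorem card_compl_union_arc_lt {g : A} {m : ℕ} {a : A} {D : Finset A}
    (h : ¬ arc g m a ⊆ D) : (D ∪ arc g m a)ᶜ.card < Dᶜ.card := by
  refine Finset.card_lt_card (Finset.compl_ssubset_compl.mpr ?_)
  refine Finset.ssubset_iff_subset_ne.mpr ⟨Finset.subset_union_left, fun hEq => h ?_⟩
  rw [hEq]
  exact Finset.subset_union_right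

theorem card_compl_union_arc_of_disjoint {g : A} (hg : ∀ x : A, ∃ k : ℕ, k • g = x) {m : ℕ}
    {a : A} {D : Finset A} (h : arc g m a ≠ Finset.univ) (hd : Disjoint D (arc g m a)) :
    (D ∪ arc g m a)ᶜ.card + m = Dᶜ.card := by
  have h1 := Finset.card_union_of_disjoint hd
  have h2 := Finset.card_compl_add_card (D ∪ arc g m a)
  have h3 := Finset.card_compl_add_card D
  have h4 := card_arc hg h
  omega

/-- Adding an arc that meets `D` does not increase the number of run starts. -/
theorem card_runStarts_union_arc_le {g : A} {m : ℕ} {a : A} {D : Finset A}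
    (hd : ¬ Disjoint D (arc g m a)) :
    (runStarts g (D ∪ arc g m a)).card ≤ (runStarts g D).card := by
  have hsub := runStarts_union_arc_subset g m a D
  by_cases he : a + m • g ∈ runStarts g (D ∪ arc g m a)
  -- A new start can only be the end of the arc. The run containing that point already had a start,
  -- which is either swallowed by the arc or equal to this end, so nothing is gained.
  · have he' := (mem_runStarts.mp he).1
    simp only [Finset.mem_union, not_or] at he'
    obtain ⟨w, hwD, hwa⟩ := Finset.not_disjoint_iff.mp hd
    obtain ⟨i, hi, rfl⟩ := mem_arc.mp hwa
    obtain ⟨k, hk0, hkm, hk⟩ := exists_runStart_of_mem hi hwD he'.1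
    rcases hkm.lt_or_eq with hlt | rfl
    · have hka : a + k • g ∈ arc g m a := mem_arc.mpr ⟨k, hlt, rfl⟩
      have h1 : (runStarts g D \ arc g m a).card < (runStarts g D).card :=
        Finset.card_lt_card (Finset.ssubset_iff_subset_ne.mpr ⟨Finset.sdiff_subset, fun hEq => by
          rw [← hEq] at hk; exact (Finset.mem_sdiff.mp hk).2 hka⟩)
      have h2 := Finset.card_le_card hsub
      have h3 := Finset.card_insert_le (a + m • g) (runStarts g D \ arc g m a)
      omega
    · refine Finset.card_le_card (hsub.trans (Finset.insert_subset hk Finset.sdiff_subset))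
  · refine Finset.card_le_card ?_
    rw [Finset.subset_insert_iff_of_notMem he] at hsub
    exact hsub.trans Finset.sdiff_subset

/-- Adding an arc that meets `D` and starts at a run start decreases the number of runs. -/
theorem card_runStarts_union_arc_lt {g : A} (hg : ∀ x : A, ∃ k : ℕ, k • g = x) {m : ℕ} {a : A}
    {D : Finset A} (ha : a ∈ runStarts g D) (hd : ¬ Disjoint D (arc g m a)) :
    (runStarts g (D ∪ arc g m a)).card < (runStarts g D).card := by
  have hsub := runStarts_union_arc_subset g m a D
  obtain ⟨w, hwD, hwa⟩ := Finset.not_disjoint_iff.mp hd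
  obtain ⟨i, hi, rfl⟩ := mem_arc.mp hwa
  have haa : a ∈ arc g m a := mem_arc.mpr ⟨0, by omega, by simp⟩
  by_cases he : a + m • g ∈ runStarts g (D ∪ arc g m a)
  · have he' := (mem_runStarts.mp he).1
    simp only [Finset.mem_union, not_or] at he'
    obtain ⟨k, hk0, hkm, hk⟩ := exists_runStart_of_mem hi hwD he'.1
    -- The run reaching past the arc is not the one starting at `a`, as otherwise the arc would wrap
    -- around; so the loss of `a` is not compensated.
    have hne : a + k • g ≠ a := by
      intro hEq
      refine he'.2 ?_
      rw [arc_eq_univ_of_nsmul_eq_zero hg hk0 hkm (by simpa using hEq) a]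
      exact Finset.mem_univ _
    rcases hkm.lt_or_eq with hlt | rfl
    · have hka : a + k • g ∈ arc g m a := mem_arc.mpr ⟨k, hlt, rfl⟩
      have h1 : runStarts g D \ arc g m a ⊆ ((runStarts g D).erase a).erase (a + k • g) := by
        intro x hx
        obtain ⟨hx1, hx2⟩ := Finset.mem_sdiff.mp hx
        refine Finset.mem_erase.mpr ⟨?_, Finset.mem_erase.mpr ⟨?_, hx1⟩⟩
        · rintro rfl; exact hx2 hka
        · rintro rfl; exact hx2 haa
      have h2 := Finset.card_le_card hsub
      have h3 := Finset.card_insert_le (a + m • g) (runStarts g D \ arc g m a)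
      have h4 := Finset.card_le_card h1
      have h5 := Finset.card_erase_add_one ha
      have h6 := Finset.card_erase_add_one (Finset.mem_erase.mpr ⟨hne, hk⟩)
      omega
    · refine (Finset.card_le_card (t := (runStarts g D).erase a) ?_).trans_lt
        (Finset.card_erase_lt_of_mem ha)
      refine hsub.trans (Finset.insert_subset (Finset.mem_erase.mpr ⟨hne, hk⟩) ?_)
      intro x hx
      obtain ⟨hx1, hx2⟩ := Finset.mem_sdiff.mp hx
      exact Finset.mem_erase.mpr ⟨by rintro rfl; exact hx2 haa, hx1⟩
  · rw [Finset.subset_insert_iff_of_notMem he] at hsub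
    refine (Finset.card_le_card (hsub.trans ?_)).trans_lt (Finset.card_erase_lt_of_mem ha)
    intro x hx
    obtain ⟨hx1, hx2⟩ := Finset.mem_sdiff.mp hx
    exact Finset.mem_erase.mpr ⟨by rintro rfl; exact hx2 haa, hx1⟩

theorem card_runStarts_union_arc_le_succ (g : A) (m : ℕ) (a : A) (D : Finset A) :
    (runStarts g (D ∪ arc g m a)).card ≤ (runStarts g D).card + 1 :=
  (Finset.card_le_card (runStarts_union_arc_subset g m a D)).trans
    ((Finset.card_insert_le _ _).trans
      (Nat.add_le_add_right (Finset.card_le_card Finset.sdiff_subset) 1))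

/-- An arc disjoint from `D` removes `c + 1` elements and creates at most one run, of weight `c`. An
arc meeting `D` removes some element and adds no run. This weight makes every legal Staller move
cost her at least 1. -/
theorem runPotential_union_arc_lt {g : A} (hg : ∀ x : A, ∃ k : ℕ, k • g = x) {c : ℕ}
    {a : A} {D : Finset A} (hD : D.Nonempty) (h : ¬ arc g (c + 1) a ⊆ D) :
    runPotential g c (D ∪ arc g (c + 1) a) < runPotential g c D := by
  unfold runPotential
  by_cases hd : Disjoint D (arc g (c + 1) a)
  · have hne : arc g (c + 1) a ≠ Finset.univ := by
      intro hEq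
      rw [hEq] at hd
      obtain ⟨x, hx⟩ := hD
      exact Finset.disjoint_left.mp hd hx (Finset.mem_univ x)
    have h1 := card_compl_union_arc_of_disjoint hg hne hd
    have h2 := Nat.mul_le_mul_left c (card_runStarts_union_arc_le_succ g (c + 1) a D)
    rw [mul_add, mul_one] at h2
    omega
  · have h1 := card_compl_union_arc_lt h
    have h2 := Nat.mul_le_mul_left c (card_runStarts_union_arc_le hd)
    omega

/-- If the arc is disjoint from `D`, all `c + 1` elements are new and the start `a` is at most
replaced by another. If it meets `D`, a whole run disappears, worth `c`, together with at least the
element `a`. -/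
theorem runPotential_union_arc_add_le {g : A} (hg : ∀ x : A, ∃ k : ℕ, k • g = x) {c : ℕ}
    {a : A} {D : Finset A} (ha : a ∈ runStarts g D) :
    runPotential g c (D ∪ arc g (c + 1) a) + (c + 1) ≤ runPotential g c D := by
  have haD := mem_runStarts.mp ha
  have haa : a ∈ arc g (c + 1) a := mem_arc.mpr ⟨0, by omega, by simp⟩
  unfold runPotential
  by_cases hd : Disjoint D (arc g (c + 1) a)
  · have hne : arc g (c + 1) a ≠ Finset.univ := by
      intro hEq
      rw [hEq] at hd
      exact Finset.disjoint_left.mp hd haD.2 (Finset.mem_univ _)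
    have h1 := card_compl_union_arc_of_disjoint hg hne hd
    have h0 : (runStarts g (D ∪ arc g (c + 1) a)).card ≤ (runStarts g D).card := by
      have hs := Finset.card_le_card (runStarts_union_arc_subset g (c + 1) a D)
      have hi := Finset.card_insert_le (a + (c + 1) • g) (runStarts g D \ arc g (c + 1) a)
      have hl : (runStarts g D \ arc g (c + 1) a).card < (runStarts g D).card :=
        Finset.card_lt_card (Finset.ssubset_iff_subset_ne.mpr ⟨Finset.sdiff_subset, fun hEq => by
          rw [← hEq] at ha; exact (Finset.mem_sdiff.mp ha).2 haa⟩)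
      omega
    have h2 := Nat.mul_le_mul_left c h0
    omega
  · have h1 := card_compl_union_arc_lt (D := D) fun hs => haD.1 (hs haa)
    have h2 := Nat.mul_le_mul_left c (card_runStarts_union_arc_lt hg ha hd)
    rw [Nat.succ_eq_add_one, mul_add, mul_one] at h2
    omega

theorem runPotential_arc_lt {g : A} (hg : ∀ x : A, ∃ k : ℕ, k • g = x) (c : ℕ) (a : A) :
    runPotential g c (arc g (c + 1) a) < Fintype.card A := by
  by_cases h : arc g (c + 1) a = Finset.univ
  · rw [h, runPotential_univ]
    exact Fintype.card_pos_iff.mpr ⟨a⟩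
  · have h1 := card_compl_union_arc_of_disjoint hg h (Finset.disjoint_empty_left _)
    have h2 := Nat.mul_le_mul_left c (card_runStarts_union_arc_le_succ g (c + 1) a ∅)
    have h3 : runStarts g (∅ : Finset A) = ∅ := by simp [runStarts]
    rw [h3, Finset.card_empty, zero_add, mul_one, Finset.empty_union] at h2
    rw [Finset.compl_empty, Finset.card_univ, Finset.empty_union] at h1
    unfold runPotential
    omega

/-- A nonempty complement has at least one element and one run, hence potential at least `c + 1`. -/
theorem eq_univ_of_runPotential_le {g : A} (hg : ∀ x : A, ∃ k : ℕ, k • g = x) {c : ℕ}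
    {D : Finset A} (hD : D.Nonempty) (h : runPotential g c D ≤ c) : D = Finset.univ := by
  by_contra hne
  obtain ⟨u, hu⟩ := exists_mem_runStarts hg hD hne
  have h1 : 0 < Dᶜ.card :=
    Finset.card_pos.mpr ⟨u, Finset.mem_compl.mpr (mem_runStarts.mp hu).1⟩
  have h2 := Nat.mul_le_mul_left c (Finset.card_pos.mpr ⟨u, hu⟩ : 0 < (runStarts g D).card)
  rw [Nat.succ_eq_add_one, zero_add, mul_one] at h2
  unfold runPotential at h
  omega

end Arcs

/-! ### One-move bounds for the game value. -/

section GameLength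

variable {V : Type*} [Fintype V] [DecidableEq V] {G : SimpleGraph V} [DecidableRel G.Adj]

theorem mem_zLegalMoves {S : Finset V} {v : V} :
    v ∈ zLegalMoves G S ↔ ∃ w, G.Adj v w ∧ w ∉ dominatedBy G S := by
  simp [zLegalMoves, Finset.Nonempty]

theorem dominatedBy_insert (v : V) (S : Finset V) :
    dominatedBy G (insert v S) = dominatedBy G S ∪ closedNbhd G v := by
  rw [dominatedBy, Finset.biUnion_insert, Finset.union_comm, dominatedBy]

theorem dominatedBy_nonempty {S : Finset V} (hS : S.Nonempty) :
    (dominatedBy G S).Nonempty := by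
  obtain ⟨s, hs⟩ := hS
  exact ⟨s, Finset.mem_biUnion.mpr ⟨s, hs, Finset.mem_insert_self _ _⟩⟩

theorem not_closedNbhd_subset_of_mem_zLegalMoves {S : Finset V} {v : V}
    (hv : v ∈ zLegalMoves G S) : ¬ closedNbhd G v ⊆ dominatedBy G S := by
  obtain ⟨w, hw, hwS⟩ := mem_zLegalMoves.mp hv
  exact fun h => hwS (h (Finset.mem_insert_of_mem ((G.mem_neighborFinset v w).mpr hw)))

theorem zGameLength_eq_zero {p : DomPlayer} {S : Finset V}
    (h : dominatedBy G S = Finset.univ) : zGameLength G p S = 0 := by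
  have : ¬ (zLegalMoves G S).Nonempty := by
    rintro ⟨v, hv⟩
    exact not_closedNbhd_subset_of_mem_zLegalMoves hv (h ▸ Finset.subset_univ _)
  rw [zGameLength, dif_neg this]

theorem zGameLength_dominator_le {S : Finset V} {v : V} (hv : v ∈ zLegalMoves G S) :
    zGameLength G .dominator S ≤ 1 + zGameLength G .staller (insert v S) := by
  rw [zGameLength, dif_pos ⟨v, hv⟩]
  exact Nat.add_le_add_left
    (Finset.inf'_le (fun v : zLegalMoves G S => zGameLength G .staller (insert v.1 S))
      (Finset.mem_attach _ ⟨v, hv⟩)) 1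

theorem le_zGameLength_staller {S : Finset V} {v : V} (hv : v ∈ zLegalMoves G S) :
    1 + zGameLength G .dominator (insert v S) ≤ zGameLength G .staller S := by
  rw [zGameLength.eq_1 G .staller S, dif_pos ⟨v, hv⟩]
  exact Nat.add_le_add_left
    (Finset.le_sup' (fun v : zLegalMoves G S => zGameLength G .dominator (insert v.1 S))
      (Finset.mem_attach _ ⟨v, hv⟩)) 1

theorem zGameLength_staller_le {S : Finset V} {k : ℕ}
    (h : ∀ v ∈ zLegalMoves G S, zGameLength G .dominator (insert v S) ≤ k) :
    zGameLength G .staller S ≤ 1 + k := by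
  rw [zGameLength]
  split_ifs
  · exact Nat.add_le_add_left (Finset.sup'_le _ _ fun v _ => h v.1 v.2) 1
  · exact Nat.zero_le _

theorem le_zGameLength_dominator {S : Finset V} {k : ℕ} (hS : (zLegalMoves G S).Nonempty)
    (h : ∀ v ∈ zLegalMoves G S, k ≤ zGameLength G .staller (insert v S)) :
    1 + k ≤ zGameLength G .dominator S := by
  rw [zGameLength, dif_pos hS]
  exact Nat.add_le_add_left (Finset.le_inf' _ _ fun v _ => h v.1 v.2) 1

end GameLength

/-! ### Strategies of both players when neighborhoods are arcs. -/

section Circulant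

variable {A : Type*} [AddCommGroup A] [Fintype A] [DecidableEq A] {G : SimpleGraph A}
  [DecidableRel G.Adj] {g : A} {n : ℕ}

/-- The number of vertices dominated in `j` moves, the next player being `p`, when Dominator
dominates `2 n + 1` vertices in each move and Staller one. -/
def moveBudget (n : ℕ) : DomPlayer → ℕ → ℕ
  | _, 0 => 0
  | .dominator, j + 1 => 2 * n + 1 + moveBudget n .staller j
  | .staller, j + 1 => 1 + moveBudget n .dominator j

theorem moveBudget_two_mul (n q : ℕ) :
    moveBudget n .dominator (2 * q) = q * (2 * n + 2) ∧
      moveBudget n .staller (2 * q) = q * (2 * n + 2) := by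
  induction q with
  | zero => simp [moveBudget]
  | succ q ih =>
    have : 2 * (q + 1) = 2 * q + 1 + 1 := by ring
    rw [this, add_mul, one_mul]
    simp only [moveBudget]
    omega

theorem nsmul_ne_zero_of_dominatedBy_ne_univ (hg : ∀ x : A, ∃ k : ℕ, k • g = x)
    (hG : ∀ v, closedNbhd G v = arc g (2 * n + 1) (v - n • g)) {S : Finset A} (hS : S.Nonempty)
    (h : dominatedBy G S ≠ Finset.univ) {k : ℕ} (hk : 0 < k) (hkn : k ≤ 2 * n + 1) :
    k • g ≠ 0 := by
  intro hk0
  obtain ⟨s, hs⟩ := hS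
  refine h (Finset.univ_subset_iff.mp ?_)
  rw [← arc_eq_univ_of_nsmul_eq_zero hg hk hkn hk0 (s - n • g), ← hG s]
  exact Finset.subset_biUnion_of_mem (closedNbhd G) hs

theorem mem_zLegalMoves_of_mem_arc
    (hG : ∀ v, closedNbhd G v = arc g (2 * n + 1) (v - n • g)) {S : Finset A} {u v : A}
    (hu : u ∉ dominatedBy G S) (hne : u ≠ v) (huv : u ∈ arc g (2 * n + 1) (v - n • g)) :
    v ∈ zLegalMoves G S := by
  rw [← hG v, closedNbhd, Finset.mem_insert] at huv
  exact mem_zLegalMoves.mpr ⟨u, (G.mem_neighborFinset v u).mp (huv.resolve_left hne), hu⟩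

theorem zGameLength_le (hn : 1 ≤ n) (hg : ∀ x : A, ∃ k : ℕ, k • g = x)
    (hG : ∀ v, closedNbhd G v = arc g (2 * n + 1) (v - n • g)) (j : ℕ) (p : DomPlayer)
    {S : Finset A} (hS : S.Nonempty)
    (h : runPotential g (2 * n) (dominatedBy G S) ≤ 2 * n + moveBudget n p j) :
    zGameLength G p S ≤ j := by
  induction j generalizing p S with
  | zero =>
    have h' : runPotential g (2 * n) (dominatedBy G S) ≤ 2 * n := by
      simpa [moveBudget] using h
    exact (zGameLength_eq_zero
      (eq_univ_of_runPotential_le hg (dominatedBy_nonempty hS) h')).le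
  | succ j ih =>
    by_cases hne : dominatedBy G S = Finset.univ
    · rw [zGameLength_eq_zero hne]; exact Nat.zero_le _
    cases p with
    | dominator =>
      obtain ⟨u, hu⟩ := exists_mem_runStarts hg (dominatedBy_nonempty hS) hne
      -- The vertex centred so that its arc begins at the run start `u`. Legality concerns open
      -- neighborhoods, so `n • g ≠ 0` is needed for `u` to be a neighbor.
      have hleg : u + n • g ∈ zLegalMoves G S := by
        refine mem_zLegalMoves_of_mem_arc hG (mem_runStarts.mp hu).1 ?_ ?_
        · have := nsmul_ne_zero_of_dominatedBy_ne_univ hg hG hS hne (k := n) (by omega) (by omega)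
          simpa using this
        · exact mem_arc.mpr ⟨0, by omega, by simp⟩
      have h1 := zGameLength_dominator_le hleg
      have h2 := ih .staller (Finset.insert_nonempty (u + n • g) S) (by
        rw [dominatedBy_insert, hG, add_sub_cancel_right]
        have := runPotential_union_arc_add_le hg (c := 2 * n) hu
        simp only [moveBudget] at h
        omega)
      omega
    | staller =>
      rw [add_comm]
      refine zGameLength_staller_le fun v hv => ih .dominator (Finset.insert_nonempty v S) ?_
      have hv' := not_closedNbhd_subset_of_mem_zLegalMoves hv
      rw [hG] at hv'
      have := runPotential_union_arc_lt hg (dominatedBy_nonempty hS) hv'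
      rw [dominatedBy_insert, hG]
      simp only [moveBudget] at h
      omega

theorem card_closedNbhd_le (hG : ∀ v, closedNbhd G v = arc g (2 * n + 1) (v - n • g)) (v : A) :
    (closedNbhd G v).card ≤ 2 * n + 1 := by
  rw [hG, arc]
  exact Finset.card_image_le.trans (Finset.card_range _).le

/-- Staller can always play a vertex that dominates exactly one new vertex. -/
theorem exists_zLegalMove_dominating_one (hn : 1 ≤ n) (hg : ∀ x : A, ∃ k : ℕ, k • g = x)
    (hG : ∀ v, closedNbhd G v = arc g (2 * n + 1) (v - n • g)) {S : Finset A} (hS : S.Nonempty)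
    (hne : dominatedBy G S ≠ Finset.univ) :
    ∃ v ∈ zLegalMoves G S, ∃ u, dominatedBy G (insert v S) ⊆ insert u (dominatedBy G S) := by
  obtain ⟨u, hu⟩ := exists_mem_runStarts hg (dominatedBy_nonempty hS) hne
  obtain ⟨hu1, hu2⟩ := mem_runStarts.mp hu
  obtain ⟨s, hs, hsu⟩ := Finset.mem_biUnion.mp hu2
  have hsub : closedNbhd G s ⊆ dominatedBy G S := Finset.subset_biUnion_of_mem (closedNbhd G) hs
  rw [hG] at hsu hsub
  obtain ⟨i, hi, hiu⟩ := mem_arc.mp hsu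
  have hu' : s - n • g + (i + 1) • g = u := by
    rw [succ_nsmul, ← add_assoc, hiu, sub_add_cancel]
  -- The arc of `s` must stop exactly before `u`, so moving its centre to `s + g` adds only `u`.
  have hi' : i = 2 * n := by
    by_contra hcon
    exact hu1 (hsub (mem_arc.mpr ⟨i + 1, by omega, hu'⟩))
  subst hi'
  have hus : u = s + g + n • g := by
    rw [← hu', succ_nsmul, two_mul, add_nsmul]; abel
  have hgn := nsmul_ne_zero_of_dominatedBy_ne_univ hg hG hS hne (k := n) (by omega) (by omega)
  refine ⟨s + g, mem_zLegalMoves_of_mem_arc hG hu1 ?_ ?_, u, ?_⟩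
  · rw [hus]; simpa using hgn
  · exact mem_arc.mpr ⟨2 * n, by omega, by rw [hus, two_mul, add_nsmul]; abel⟩
  · rw [dominatedBy_insert, hG]
    refine Finset.union_subset (Finset.subset_insert _ _) fun x hx => ?_
    obtain ⟨k, hk, rfl⟩ := mem_arc.mp hx
    have hshift : s + g - n • g + k • g = s - n • g + (k + 1) • g := by
      rw [succ_nsmul]; abel
    rw [hshift]
    rcases Nat.lt_succ_iff_lt_or_eq.mp hk with hlt | rfl
    · exact Finset.mem_insert_of_mem (hsub (mem_arc.mpr ⟨k + 1, by omega, rfl⟩))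
    · rw [hu']; exact Finset.mem_insert_self _ _

theorem exists_zLegalMove_of_ne_univ (hn : 1 ≤ n)
    (hG : ∀ v, closedNbhd G v = arc g (2 * n + 1) (v - n • g)) (hg0 : g ≠ 0) {S : Finset A}
    (hne : dominatedBy G S ≠ Finset.univ) : (zLegalMoves G S).Nonempty := by
  obtain ⟨u, hu⟩ : ∃ u, u ∉ dominatedBy G S := by
    by_contra! h
    exact hne (Finset.eq_univ_of_forall h)
  refine ⟨u + g, mem_zLegalMoves_of_mem_arc hG hu (by simpa using hg0) ?_⟩
  refine mem_arc.mpr ⟨n - 1, by omega, ?_⟩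
  have : n • g = (n - 1) • g + g := by rw [← succ_nsmul]; congr 1; omega
  rw [this]; abel

/-- Staller's one-vertex move needs an earlier move to sit beside, hence the condition on `S` when
she is next. -/
theorem lt_zGameLength (hn : 1 ≤ n) (hg : ∀ x : A, ∃ k : ℕ, k • g = x)
    (hG : ∀ v, closedNbhd G v = arc g (2 * n + 1) (v - n • g)) (hg0 : g ≠ 0) (j : ℕ)
    (p : DomPlayer) {S : Finset A} (hS : p = .dominator ∨ S.Nonempty)
    (h : moveBudget n p j < (dominatedBy G S)ᶜ.card) : j < zGameLength G p S := by
  induction j generalizing p S with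
  | zero =>
    have hne : dominatedBy G S ≠ Finset.univ := by
      intro hEq
      simp [hEq] at h
    obtain ⟨v, hv⟩ := exists_zLegalMove_of_ne_univ hn hG hg0 hne
    cases p with
    | dominator =>
      have := le_zGameLength_dominator (k := 0) ⟨v, hv⟩ fun _ _ => Nat.zero_le _
      omega
    | staller =>
      have := le_zGameLength_staller hv
      omega
  | succ j ih =>
    have hne : dominatedBy G S ≠ Finset.univ := by
      intro hEq
      simp [hEq] at h
    cases p with
    | dominator =>
      have := le_zGameLength_dominator (k := j + 1)
        (exists_zLegalMove_of_ne_univ hn hG hg0 hne) fun v _ =>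
          ih .staller (Or.inr (Finset.insert_nonempty v S)) (by
            rw [dominatedBy_insert]
            have h1 := Finset.card_union_le (dominatedBy G S) (closedNbhd G v)
            have h2 := card_closedNbhd_le hG v
            have h3 := Finset.card_compl_add_card (dominatedBy G S)
            have h4 := Finset.card_compl_add_card (dominatedBy G S ∪ closedNbhd G v)
            simp only [moveBudget] at h
            omega)
      omega
    | staller =>
      obtain ⟨v, hv, u, hu⟩ := exists_zLegalMove_dominating_one hn hg hG
        (hS.resolve_left (by simp)) hne
      have h1 := le_zGameLength_staller hv
      have h2 := ih .dominator (S := insert v S) (Or.inl rfl) (by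
        have h1 := (Finset.card_le_card hu).trans (Finset.card_insert_le _ _)
        have h3 := Finset.card_compl_add_card (dominatedBy G S)
        have h4 := Finset.card_compl_add_card (dominatedBy G (insert v S))
        simp only [moveBudget] at h
        omega)
      omega

/-- The game Z-domination number of a circulant graph whose closed neighborhoods are the arcs
of `2 n + 1` consecutive elements. -/
theorem gameZDominationNumber_of_closedNbhd_eq_arc (hn : 1 ≤ n)
    (hg : ∀ x : A, ∃ k : ℕ, k • g = x) (hg0 : g ≠ 0)
    (hG : ∀ v, closedNbhd G v = arc g (2 * n + 1) (v - n • g)) :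
    gameZDominationNumber G = 2 * (Fintype.card A / (2 * n + 2)) +
      if Fintype.card A % (2 * n + 2) = 0 then 0 else 1 := by
  have hempty : dominatedBy G (∅ : Finset A) = ∅ := by simp [dominatedBy]
  have hpos : 0 < Fintype.card A := Fintype.card_pos_iff.mpr ⟨0⟩
  have hlower : ∀ j, moveBudget n .dominator j < Fintype.card A →
      j < gameZDominationNumber G := fun j hj =>
    lt_zGameLength hn hg hG hg0 j .dominator (Or.inl rfl) (by simpa [hempty] using hj)
  have hupper : ∀ j, Fintype.card A ≤ 2 * n + 1 + moveBudget n .staller j →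
      gameZDominationNumber G ≤ 1 + j := by
    intro j hj
    obtain ⟨v, hv⟩ := exists_zLegalMove_of_ne_univ hn hG hg0 (S := ∅) (by
      rw [hempty]
      exact fun hEq => Finset.notMem_empty (0 : A) (hEq ▸ Finset.mem_univ _))
    refine (zGameLength_dominator_le hv).trans (Nat.add_le_add_left ?_ 1)
    refine zGameLength_le hn hg hG j .staller (Finset.insert_nonempty v ∅) ?_
    rw [dominatedBy_insert, hempty, Finset.empty_union, hG]
    have := runPotential_arc_lt hg (2 * n) (v - n • g)
    omega
  have hdiv := Nat.div_add_mod (Fintype.card A) (2 * n + 2)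
  have hmod := Nat.mod_lt (Fintype.card A) (show 0 < 2 * n + 2 by omega)
  generalize Fintype.card A / (2 * n + 2) = q at *
  generalize Fintype.card A % (2 * n + 2) = r at *
  rw [mul_comm] at hdiv
  split_ifs with hr
  -- For `r = 0` the last of the `2q` moves is Staller's, so the budgets are compared one move
  -- earlier, at `2q - 1`; `q = 0` would give no vertices.
  · cases q with
    | zero => omega
    | succ q =>
      have hb := moveBudget_two_mul n q
      rw [add_mul, one_mul] at hdiv
      have h1 := hlower (2 * q + 1) (by simp only [moveBudget]; omega)
      have h2 := hupper (2 * q + 1) (by simp only [moveBudget]; omega)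
      omega
  · have hb := moveBudget_two_mul n q
    have h1 := hlower (2 * q) (by omega)
    have h2 := hupper (2 * q) (by omega)
    omega

end Circulant

/-! ### Distances and neighborhoods in powers of the cycle. -/

theorem edist_cycleGraph_add_nsmul_le (m k : ℕ) (u : Fin (m + 2)) :
    (SimpleGraph.cycleGraph (m + 2)).edist u (u + k • 1) ≤ k := by
  induction k with
  | zero => simp
  | succ k ih =>
    have hadj : (SimpleGraph.cycleGraph (m + 2)).Adj (u + k • 1) (u + (k + 1) • 1) := by
      rw [SimpleGraph.cycleGraph_adj, succ_nsmul]
      right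
      abel
    refine SimpleGraph.edist_triangle.trans ((add_le_add ih
      (SimpleGraph.edist_le_one_iff_adj_or_eq.mpr (Or.inl hadj))).trans ?_)
    push_cast
    exact le_rfl

theorem exists_nsmul_eq_sub_of_walk {m : ℕ} {u v : Fin (m + 2)}
    (p : (SimpleGraph.cycleGraph (m + 2)).Walk u v) :
    ∃ k ≤ p.length, k • (1 : Fin (m + 2)) = u - v ∨ k • (1 : Fin (m + 2)) = v - u := by
  induction p with
  | nil => exact ⟨0, le_rfl, by simp⟩
  | @cons u w v h p ih =>
    rw [SimpleGraph.Walk.length_cons]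
    obtain ⟨k, hk, hkw⟩ := ih
    have hsplit : u - v = (u - w) + (w - v) ∧ v - u = (v - w) + (w - u) := by
      constructor <;> abel
    have hneg : w - v = -(v - w) ∧ v - w = -(w - v) := by
      constructor <;> abel
    have hneg' : u - w = -(w - u) ∧ w - u = -(u - w) := by
      constructor <;> abel
    rw [hsplit.1, hsplit.2]
    rcases SimpleGraph.cycleGraph_adj.mp h with h1 | h1 <;> rcases hkw with hk1 | hk1
    · exact ⟨k + 1, by omega, Or.inl (by rw [succ_nsmul', hk1, h1])⟩
    -- The edge opposes the remaining displacement and cancels one step of it, unless that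
    -- displacement is zero.
    · cases k with
      | zero => exact ⟨1, by omega, Or.inl (by rw [hneg.1, ← hk1, h1]; simp)⟩
      | succ k =>
        exact ⟨k, by omega, Or.inr (by rw [hneg'.2, h1, ← hk1, succ_nsmul]; abel)⟩
    · cases k with
      | zero => exact ⟨1, by omega, Or.inr (by rw [hneg.2, ← hk1, h1]; simp)⟩
      | succ k =>
        exact ⟨k, by omega, Or.inl (by rw [hneg'.1, h1, ← hk1, succ_nsmul]; abel)⟩
    · exact ⟨k + 1, by omega, Or.inr (by rw [succ_nsmul, hk1, h1])⟩

theorem edist_cycleGraph_le_iff {m n : ℕ} {u v : Fin (m + 2)} :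
    (SimpleGraph.cycleGraph (m + 2)).edist u v ≤ n ↔
      ∃ k ≤ n, k • (1 : Fin (m + 2)) = u - v ∨ k • (1 : Fin (m + 2)) = v - u := by
  constructor
  · intro h
    obtain ⟨p, hp⟩ := SimpleGraph.exists_walk_of_edist_ne_top
      (h.trans_lt (ENat.natCast_lt_top n)).ne
    obtain ⟨k, hk, hkuv⟩ := exists_nsmul_eq_sub_of_walk p
    rw [← hp] at h
    exact ⟨k, hk.trans (by exact_mod_cast h), hkuv⟩
  · rintro ⟨k, hk, h | h⟩
    · have := edist_cycleGraph_add_nsmul_le m k v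
      rw [h, add_sub_cancel, SimpleGraph.edist_comm] at this
      exact this.trans (by exact_mod_cast hk)
    · have := edist_cycleGraph_add_nsmul_le m k u
      rw [h, add_sub_cancel] at this
      exact this.trans (by exact_mod_cast hk)

theorem closedNbhd_graphPower_cycleGraph (m n : ℕ)
    [DecidableRel (graphPower (SimpleGraph.cycleGraph (m + 2)) n).Adj] (v : Fin (m + 2)) :
    closedNbhd (graphPower (SimpleGraph.cycleGraph (m + 2)) n) v =
      arc (1 : Fin (m + 2)) (2 * n + 1) (v - n • 1) := by
  ext w
  have h1 : w ∈ closedNbhd (graphPower (SimpleGraph.cycleGraph (m + 2)) n) v ↔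
      (SimpleGraph.cycleGraph (m + 2)).edist v w ≤ n := by
    rw [closedNbhd, Finset.mem_insert, SimpleGraph.mem_neighborFinset]
    change w = v ∨ (v ≠ w ∧ _) ↔ _
    by_cases hvw : w = v
    · simp [hvw]
    · simp [hvw, Ne.symm hvw]
  rw [h1, edist_cycleGraph_le_iff, mem_arc]
  constructor
  · rintro ⟨k, hk, h | h⟩
    · refine ⟨n - k, by omega, ?_⟩
      have : n • (1 : Fin (m + 2)) = (n - k) • 1 + k • 1 := by
        rw [← add_nsmul]; congr 1; omega
      rw [this, h]; abel
    · refine ⟨n + k, by omega, ?_⟩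
      rw [add_nsmul, h]; abel
  · rintro ⟨i, hi, rfl⟩
    rcases le_total i n with hin | hin
    · refine ⟨n - i, by omega, Or.inl ?_⟩
      have : n • (1 : Fin (m + 2)) = (n - i) • 1 + i • 1 := by
        rw [← add_nsmul]; congr 1; omega
      rw [this]; abel
    · refine ⟨i - n, by omega, Or.inr ?_⟩
      have : i • (1 : Fin (m + 2)) = (i - n) • 1 + n • 1 := by
        rw [← add_nsmul]; congr 1; omega
      rw [this]; abel

theorem exists_nsmul_one_eq (m : ℕ) (x : Fin (m + 2)) : ∃ k : ℕ, k • (1 : Fin (m + 2)) = x := by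
  induction x using Fin.induction with
  | zero => exact ⟨0, by simp⟩
  | succ i ih =>
    obtain ⟨k, hk⟩ := ih
    exact ⟨k + 1, by rw [succ_nsmul, hk, Fin.coeSucc_eq_succ]⟩

/-! ### Comparison with the ceiling formula. -/

/-- Here `N / (n + 1) = 2q + r / (n + 1)`, and the hypotheses say that `c` is the ceiling of `r / (n
+ 1)`; it is 0, 1 or 2 in the cases of the theorem. -/
theorem ceil_div_eq {n N q r c : ℕ} (hN : N = q * (2 * n + 2) + r)
    (h1 : (c : ℤ) * (n + 1) < r + (n + 1)) (h2 : r ≤ c * (n + 1)) :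
    ⌈(N : ℚ) / ((n : ℚ) + 1)⌉ = 2 * q + c := by
  have hpos : (0 : ℚ) < (n : ℚ) + 1 := by positivity
  have h1' : (c : ℚ) * (n + 1) < r + (n + 1) := by exact_mod_cast h1
  have h2' : (r : ℚ) ≤ c * (n + 1) := by exact_mod_cast h2
  rw [Int.ceil_eq_iff, lt_div_iff₀ hpos, div_le_iff₀ hpos, hN]
  push_cast
  constructor <;> linarith

theorem mainTheorem8 (n N : ℕ) (hn : 1 ≤ n) (hN : 3 ≤ N)
    [DecidableRel (graphPower (SimpleGraph.cycleGraph N) n).Adj] :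
    (N % (2 * n + 2) ∈ Set.Icc 0 (n + 1) →
      (gameZDominationNumber (graphPower (SimpleGraph.cycleGraph N) n) : ℤ)
        = ⌈(N : ℚ) / ((n : ℚ) + 1)⌉) ∧
    (N % (2 * n + 2) ∈ Set.Icc (n + 2) (2 * n + 1) →
      (gameZDominationNumber (graphPower (SimpleGraph.cycleGraph N) n) : ℤ)
        = ⌈(N : ℚ) / ((n : ℚ) + 1)⌉ - 1) := by
  obtain ⟨m, rfl⟩ : ∃ m, N = m + 2 := ⟨N - 2, by omega⟩
  rw [gameZDominationNumber_of_closedNbhd_eq_arc hn (exists_nsmul_one_eq m) one_ne_zero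
    (closedNbhd_graphPower_cycleGraph m n), Fintype.card_fin]
  have hdiv := Nat.div_add_mod' (m + 2) (2 * n + 2)
  generalize (m + 2) / (2 * n + 2) = q at *
  generalize (m + 2) % (2 * n + 2) = r at *
  constructor
  · rintro ⟨-, hr⟩
    split_ifs with h0
    · rw [ceil_div_eq (c := 0) hdiv.symm (by push_cast; omega) (by omega)]
      push_cast; ring
    · rw [ceil_div_eq (c := 1) hdiv.symm (by push_cast; omega) (by omega)]
      push_cast; ring
  · rintro ⟨hr1, hr2⟩
    rw [if_neg (by omega), ceil_div_eq (c := 2) hdiv.symm (by push_cast; omega) (by omega)]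
    push_cast; ring
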